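/- Let $n \ge 0$ and let $D$ be a tournament on the vertex set $[n]=\{1,\dots,n\}$, that is, a directed graph without loops in which, for any two distinct vertices $i,j$, exactly one of $(i,j)$ and $(j,i)$ is an edge. The Rédei–Berge symmetric function of $D$ is $$\mathcal{U}_D := \sum_{\pi\in\mathfrak{S}_n} F_{\mathrm{Des}_D(\pi)}\in\mathbb{Q}[[z_1,z_2,\dots]],\qquad \mathrm{Des}_D(\pi)=\{\,i\in[n-1] : (\pi(i),\pi(i+1)) \text{ is an edge of } D\,\},$$ where, for $I\subseteq[n-1]$, $$F_I=\sum_{\substack{1\le i_1\le\cdots\le i_n\\ i_j<i_{j+1}\text{ for }j\in I}} z_{i_1}z_{i_2}\cdots z_{i_n}$$ is the fundamental quasisymmetric function. For $k\ge 1$ let $p_k=\sum_{i\ge 1}z_i^k$, and for a permutation $\sigma\in\mathfrak{S}_n$ let $p_{\mathrm{cyc}(\sigma)}$ be the product of the $p_\ell$ over the lengths $\ell$ of all the cycles of $\sigma$ (fixed points included). Let $\psi(\sigma)$ be the number of nontrivial cycles (cycles of length at least $2$) of $\sigma$. Let $\mathfrak{S}(D)$ be the set of those $\sigma\in\mathfrak{S}_n$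 such that, for every nontrivial cycle $(i_0\ i_1\ \cdots\ i_k)$ of $\sigma$, all of $(i_0,i_1),(i_1,i_2),\dots,(i_{k-1},i_k),(i_k,i_0)$ are edges of $D$. Then $$\mathcal{U}_D=\sum_{\substack{\sigma\in\mathfrak{S}(D)\\ \text{all cycles of }\sigma\text{ have odd length}}}2^{\psi(\sigma)}\,p_{\mathrm{cyc}(\sigma)}.$$ In particular, $\mathcal{U}_D\in\mathbb{Z}[p_1,2p_3,2p_5,2p_7,\dots]$, the subring of $\mathbb{Q}[[z_1,z_2,\dots]]$ generated by $p_1$ and the $2p_{2k+1}$ with $k\ge1$. -/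

import Mathlib

namespace RedeiBerge

/-- A digraph is a tournament when it has no loops and, for any two distinct vertices `i`, `j`,
exactly one of `(i, j)` and `(j, i)` is an edge. -/
def IsTournament {V : Type*} (D : Digraph V) : Prop :=
  (∀ i, ¬ D.Adj i i) ∧ ∀ i j, i ≠ j → Xor (D.Adj i j) (D.Adj j i)

/-- The word `s 0, s 1, …, s (n - 1)` is weakly increasing, and strictly increasing at the positions
in `I`. Positions and letters are counted from `0`: the element `j` of `Fin (n - 1)` is the
pair of consecutive places `j`, `j + 1` of the word. -/
def Admissible (n : ℕ) (I : Set (Fin (n - 1))) (s : Fin n → ℕ) : Prop :=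
  Monotone s ∧ ∀ j ∈ I, s ⟨j, by omega⟩ < s ⟨j + 1, by omega⟩

/-- The exponent vector of the monomial `z_{s 0} z_{s 1} ⋯ z_{s (n - 1)}`. -/
noncomputable def wordExponent {n : ℕ} (s : Fin n → ℕ) : ℕ →₀ ℕ :=
  ∑ j, Finsupp.single (s j) 1

theorem finite_words {n : ℕ} (m : ℕ →₀ ℕ) : {s : Fin n → ℕ | wordExponent s = m}.Finite := by
  refine (Set.Finite.pi' (fun _ : Fin n => m.support.finite_toSet)).subset ?_
  rintro s rfl j
  simp only [Finset.mem_coe, Finsupp.mem_support_iff, wordExponent, Finsupp.finsetSum_apply]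
  refine fun h => ?_
  have := (Finset.sum_eq_zero_iff.1 h) j (Finset.mem_univ j)
  simp at this

/-- The fundamental quasisymmetric function `F_I`, `I ⊆ [n - 1]`, as a power series in the
variables `z_0, z_1, z_2, …`: the sum of the monomials of all admissible words. The coefficient at
an exponent vector `m` is the number of words whose monomial is `z ^ m`, a finite number by
`finite_words`. -/
noncomputable def fundamental (n : ℕ) (I : Set (Fin (n - 1))) : MvPowerSeries ℕ ℚ :=
  fun m => ({s : Fin n → ℕ | Admissible n I s ∧ wordExponent s = m}.ncard : ℚ)

/-- The set of `D`-descents of a permutation `π`: the positions `j` such that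
`(π j, π (j + 1))` is an edge of `D`. -/
def descents {n : ℕ} (D : Digraph (Fin n)) (π : Equiv.Perm (Fin n)) : Set (Fin (n - 1)) :=
  {j | D.Adj (π ⟨j, by omega⟩) (π ⟨j + 1, by omega⟩)}

/-- The Rédei–Berge symmetric function of a digraph on `n` vertices. -/
noncomputable def redeiBerge {n : ℕ} (D : Digraph (Fin n)) : MvPowerSeries ℕ ℚ :=
  ∑ π : Equiv.Perm (Fin n), fundamental n (descents D π)

/-- The power sum `p_k = z_0 ^ k + z_1 ^ k + ⋯`, for `k ≥ 1`. -/
noncomputable def powerSum (k : ℕ) : MvPowerSeries ℕ ℚ :=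
  fun m => ({i : ℕ | Finsupp.single i k = m}.ncard : ℚ)

/-- `p_λ = p_{λ_1} p_{λ_2} ⋯` for a partition `λ`. -/
noncomputable def powerSumPartition {n : ℕ} (μ : n.Partition) : MvPowerSeries ℕ ℚ :=
  (μ.parts.map powerSum).prod

/-- A cyclic permutation `c = (i_0 i_1 ⋯ i_k)`, `k ≥ 1`, is a `D`-cycle when each of
`(i_0, i_1), (i_1, i_2), …, (i_k, i_0)` is an edge of `D`. -/
def IsDCycle {n : ℕ} (D : Digraph (Fin n)) (c : Equiv.Perm (Fin n)) : Prop :=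
  c.IsCycle ∧ ∀ i ∈ c.support, D.Adj i (c i)

/-- The set `𝔖(D)` of the permutations all of whose nontrivial cycles are `D`-cycles. -/
def cyclePerms {n : ℕ} (D : Digraph (Fin n)) : Set (Equiv.Perm (Fin n)) :=
  {σ | ∀ c ∈ σ.cycleFactorsFinset, IsDCycle D c}

/-- The number of nontrivial cycles of a permutation. -/
def numNontrivialCycles {n : ℕ} (σ : Equiv.Perm (Fin n)) : ℕ :=
  σ.cycleFactorsFinset.card

end RedeiBerge

/-!
The coefficient of a monomial in `redeiBerge D` is a sum over the labellings `f` of the vertices with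
that monomial: it counts the listings of the vertices along which `f` never decreases and that have
no edge of `D` between neighbours of the same label (`coeff_redeiBerge`). These are the Hamiltonian
paths of the digraph with the edges `(a, b)` for which `f a < f b`, or `f a = f b` and `(a, b)` is
not an edge of `D`. Correspondingly, `p_{cyc σ}` counts the labellings that are constant on the
cycles of `σ` (`coeff_powerSumPartition`). So everything is about Hamiltonian paths.

For any weight matrix `w` on a finite set `V`, the weighted number of Hamiltonian paths is
`∑ per(w[A]) det((1 - w)[B])`, summed over `A ⊔ B = V`, where `1` is the all-ones matrix
(`sum_orderingWeight`). Indeed, let `F(S, u)` be the sum of `(-1) ^ |B| per(w[A]) det(w[B])` over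
`A ⊔ B = S`, with the determinant bordered by the row `u` and by a column of ones. Laplace expansion
along the row `u` is the recursion that removes the first step of a path from `u` through `S`
(`borderDet_eq`), up to a term that vanishes unless `S` is empty, because the unbordered sum does
(`permDet_eq`). That sum vanishes since bordering the permanent instead of the determinant leads to
the same recursion. The sum of `F(S \ x, x)` over `x` gives `det((1 - w)[B])`, as
`1` has rank one.

For the digraph above, an entry of `w` between different labels is zero when it goes down, and
an entry of `1 - w` is zero when it goes up. A permutation that changes the labels has entries of both
kinds, so only entries between equal labels matter (`immanant_eq_of_level`). There `1 - w` is
the adjacency matrix `E` of `D`, and, `D` being a tournament, `w` is the transpose of `E + I`, with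
`I` the identity matrix, so its permanents are those of `E + I`. Therefore the sum runs over the
permutations along `E` with some of their cycles marked, a marked cycle contributing its sign. This
is a product of factors `1 + sign c` (`sum_immanant_rel`): `2` for an odd cycle, `0` for an even one.
-/

namespace RedeiBerge

open Equiv Equiv.Perm

/-! ### Immanants of principal submatrices -/

section Immanant

/-- The matrix `w` with column `u` replaced by `c`. -/
def setCol {V : Type*} [DecidableEq V] (w : V → V → ℤ) (u : V) (c : V → ℤ) : V → V → ℤ :=
  fun a b => if b = u then c a else w a b

theorem setCol_self {V : Type*} [DecidableEq V] (w : V → V → ℤ) (u : V) :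
    setCol w u (fun a => w a u) = w := by
  funext a b
  simp only [setCol]
  split_ifs with h <;> simp [h]

variable {V : Type*} [Fintype V] [DecidableEq V]

/-- The permutations of `V` that fix every point outside `A`, standing for the permutations
of `A`. -/
def permsOn (A : Finset V) : Finset (Perm V) :=
  Finset.univ.filter fun σ => ∀ a, a ∉ A → σ a = a

theorem mem_permsOn {A : Finset V} {σ : Perm V} : σ ∈ permsOn A ↔ ∀ a, a ∉ A → σ a = a := by
  simp [permsOn]

theorem apply_mem_of_mem_permsOn {A : Finset V} {σ : Perm V} (h : σ ∈ permsOn A) {a : V} :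
    σ a ∈ A ↔ a ∈ A := by
  rw [mem_permsOn] at h
  constructor
  · intro h1
    by_contra h2
    rw [h a h2] at h1
    exact h2 h1
  · intro h1
    by_contra h2
    rw [σ.injective (h _ h2)] at h2
    exact h2 h1

/-- A permutation of `A ∪ {u}` is determined by the image `x` of `u` and by the permutation
of `A` obtained by cutting `u` out of its cycle. -/
theorem sum_permsOn_insert {A : Finset V} {u : V} (hu : u ∉ A) (g : Perm V → ℤ) :
    ∑ σ ∈ permsOn (insert u A), g σ =
      ∑ x ∈ insert u A, ∑ τ ∈ permsOn A, g (swap u x * τ) := by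
  rw [← Finset.sum_product']
  refine Finset.sum_bij' (fun σ _ => (σ u, swap u (σ u) * σ)) (fun p _ => swap u p.1 * p.2)
    ?_ ?_ ?_ ?_ ?_
  · intro σ hσ
    rw [Finset.mem_product]
    refine ⟨(apply_mem_of_mem_permsOn hσ).2 (Finset.mem_insert_self _ _), ?_⟩
    rw [mem_permsOn] at hσ ⊢
    intro a ha
    by_cases hau : a = u
    · simp [hau]
    · have h1 : σ a = a := hσ a (by simp [hau, ha])
      have h2 : a ≠ σ u := fun h => hau (σ.injective (h1.trans h))
      simp [h1, swap_apply_of_ne_of_ne hau h2]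
  · rintro ⟨x, τ⟩ h
    rw [Finset.mem_product] at h
    obtain ⟨hx, hτ⟩ := h
    rw [mem_permsOn] at hτ ⊢
    intro a ha
    simp only [Finset.mem_insert, not_or] at ha hx
    have h1 : a ≠ x := by
      rintro rfl
      tauto
    simp [hτ a ha.2, swap_apply_of_ne_of_ne ha.1 h1]
  · intro σ _
    simp
  · rintro ⟨x, τ⟩ h
    rw [Finset.mem_product, mem_permsOn] at h
    simp [h.2 u hu]
  · intro σ _
    simp

/-- The immanant `∑ σ, χ σ ∏ a, w a (σ a)` of the principal submatrix of `w` on the rows and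
columns in `A`: its permanent for `χ = 1`, its determinant for `χ = sign`. -/
def immanant (χ : Perm V →* ℤˣ) (w : V → V → ℤ) (A : Finset V) : ℤ :=
  ∑ σ ∈ permsOn A, (χ σ : ℤ) * ∏ a ∈ A, w a (σ a)

theorem immanant_neg (χ : Perm V →* ℤˣ) (w : V → V → ℤ) (A : Finset V) :
    immanant χ (fun a b => -w a b) A = (-1) ^ A.card * immanant χ w A := by
  simp only [immanant, Finset.prod_neg, Finset.mul_sum]
  exact Finset.sum_congr rfl fun σ _ => by ring

/-- The permanent is invariant under transposition. -/
theorem immanant_one_transpose (w : V → V → ℤ) (A : Finset V) :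
    immanant 1 (fun a b => w b a) A = immanant 1 w A := by
  refine Finset.sum_bij' (fun σ _ => σ⁻¹) (fun σ _ => σ⁻¹) ?_ ?_ ?_ ?_ ?_
  · intro σ hσ
    rw [mem_permsOn] at hσ ⊢
    exact fun a ha => by rw [inv_eq_iff_eq, hσ a ha]
  · intro σ hσ
    rw [mem_permsOn] at hσ ⊢
    exact fun a ha => by rw [inv_eq_iff_eq, hσ a ha]
  · simp
  · simp
  · intro σ hσ
    congr 1
    refine Finset.prod_bij' (fun a _ => σ a) (fun a _ => σ⁻¹ a) ?_ ?_ ?_ ?_ ?_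
    · exact fun a ha => (apply_mem_of_mem_permsOn hσ).2 ha
    · intro a ha
      rw [← apply_mem_of_mem_permsOn hσ]
      simpa using ha
    · simp
    · simp
    · simp

/-- Laplace expansion along the row `u`, the column `u` being `c`. The minor of row `u` and
column `x` still has the column `c`, which takes over the place of the column `x`. -/
theorem immanant_insert {χ : Perm V →* ℤˣ} {e : ℤ} (he : ∀ x y : V, x ≠ y → (χ (swap x y) : ℤ) = e)
    (w : V → V → ℤ) {A : Finset V} {u : V} (hu : u ∉ A) (c : V → ℤ) :
    immanant χ (setCol w u c) (insert u A) =
      c u * immanant χ w A + e * ∑ x ∈ A, w u x * immanant χ (setCol w x c) A := by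
  rw [immanant, sum_permsOn_insert hu, Finset.sum_insert hu]
  congr 1
  · rw [immanant, Finset.mul_sum]
    refine Finset.sum_congr rfl fun τ hτ => ?_
    have h1 : τ u = u := mem_permsOn.1 hτ u hu
    have h2 : ∏ a ∈ A, setCol w u c a ((swap u u * τ) a) = ∏ a ∈ A, w a (τ a) := by
      refine Finset.prod_congr rfl fun a ha => ?_
      have h3 : τ a ≠ u := fun h => hu (h ▸ (apply_mem_of_mem_permsOn hτ).2 ha)
      simp [setCol, h3]
    rw [Finset.prod_insert hu, h2]
    simp only [swap_self, mul_apply, h1, refl_apply, setCol, if_true]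
    rw [← Perm.one_def, one_mul]
    ring
  · rw [Finset.mul_sum]
    refine Finset.sum_congr rfl fun x hx => ?_
    have hxu : x ≠ u := fun h => hu (h ▸ hx)
    rw [immanant, Finset.mul_sum, Finset.mul_sum]
    refine Finset.sum_congr rfl fun τ hτ => ?_
    have h1 : τ u = u := mem_permsOn.1 hτ u hu
    have h2 : ∏ a ∈ A, setCol w u c a ((swap u x * τ) a) = ∏ a ∈ A, setCol w x c a (τ a) := by
      refine Finset.prod_congr rfl fun a ha => ?_
      have h3 : τ a ≠ u := fun h => hu (h ▸ (apply_mem_of_mem_permsOn hτ).2 ha)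
      by_cases h4 : τ a = x
      · simp [setCol, h4]
      · simp [setCol, h4, h3, swap_apply_of_ne_of_ne h3 h4]
    rw [Finset.prod_insert hu, h2, map_mul, Units.val_mul, he u x hxu.symm]
    simp only [mul_apply, h1, swap_apply_left, setCol, hxu, if_false]
    ring

/-! ### Subtracting a rank one matrix from a determinant -/

/-- Expansion by multilinearity: two columns equal to `c` give zero. -/
theorem det_sub_cols (M : Matrix V V ℤ) (c : V → ℤ) (T : Finset V) :
    (Matrix.of fun i j => M i j - if j ∈ T then c i else 0).det =
      M.det - ∑ x ∈ T, (M.updateCol x c).det := by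
  induction T using Finset.induction_on with
  | empty =>
    simp only [Finset.notMem_empty, if_false, sub_zero, Finset.sum_empty]
    rfl
  | insert y T hy ih =>
    set N : Matrix V V ℤ := Matrix.of fun i j => M i j - if j ∈ T then c i else 0 with hN
    have h1 : (Matrix.of fun i j => M i j - if j ∈ insert y T then c i else 0) =
        N.updateCol y ((fun i => N i y) + (-1 : ℤ) • c) := by
      ext i j
      by_cases hj : j = y
      · subst hj
        simp [hN, hy, sub_eq_add_neg]
      · simp [hN, hj]
    have h2 : N.updateCol y (fun i => N i y) = N := by
      ext i j
      by_cases hj : j = y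
      · subst hj
        simp
      · simp [hj]
    -- the columns in `T` differ by multiples of the column `y`, which is `c` on both sides
    have h3 : (N.updateCol y c).det = (M.updateCol y c).det := by
      rw [← Matrix.det_transpose, ← Matrix.det_transpose (M.updateCol y c)]
      refine Matrix.det_eq_of_forall_row_eq_smul_add_const (fun i => if i ∈ T then -1 else 0) y
        (by simp [hy]) fun i j => ?_
      by_cases hi : i = y
      · subst hi
        simp [hy]
      · by_cases hT : i ∈ T <;> simp [hN, hi, hT, sub_eq_add_neg]
    rw [h1, Matrix.det_updateCol_add, h2, Matrix.det_updateCol_smul, h3, ih,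
      Finset.sum_insert hy]
    ring

/-- The matrix `w` with the rows and columns outside `B` made those of the identity. -/
def principal (w : V → V → ℤ) (B : Finset V) : Matrix V V ℤ :=
  Matrix.of fun a b => if a ∈ B ∧ b ∈ B then w a b else if a = b then 1 else 0

theorem immanant_sign_eq_det (w : V → V → ℤ) (B : Finset V) :
    immanant sign w B = (principal w B).det := by
  rw [← Matrix.det_transpose, Matrix.det_apply', immanant]
  refine Finset.sum_subset_zero_on_sdiff (Finset.subset_univ _) ?_ ?_
  · intro σ hσ
    simp only [Finset.mem_sdiff, Finset.mem_univ, true_and, mem_permsOn, not_forall] at hσ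
    obtain ⟨a, ha, hne⟩ := hσ
    rw [Finset.prod_eq_zero (Finset.mem_univ a), mul_zero]
    simp [principal, ha, Ne.symm hne]
  · intro σ hσ
    congr 1
    refine Finset.prod_subset_one_on_sdiff (Finset.subset_univ _) ?_ ?_
    · intro a ha
      have ha : a ∉ B := by simpa using ha
      simp [principal, ha, mem_permsOn.1 hσ a ha]
    · intro a ha
      simp [principal, ha, apply_mem_of_mem_permsOn hσ]

theorem immanant_sign_sub_one (w : V → V → ℤ) (B : Finset V) :
    immanant sign (fun a b => w a b - 1) B =
      immanant sign w B - ∑ x ∈ B, immanant sign (setCol w x 1) B := by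
  simp only [immanant_sign_eq_det]
  rw [show principal (fun a b => w a b - 1) B = Matrix.of fun i j => principal w B i j -
      if j ∈ B then (if i ∈ B then 1 else 0) else 0 from ?_, det_sub_cols]
  · congr 1
    refine Finset.sum_congr rfl fun x hx => ?_
    congr 1
    ext a b
    by_cases hb : b = x
    · subst hb
      by_cases ha : a ∈ B
      · simp [principal, setCol, ha, hx]
      · have : a ≠ b := fun h => ha (h ▸ hx)
        simp [principal, ha, this]
    · simp [principal, setCol, hb]
  · ext a b
    by_cases ha : a ∈ B <;> by_cases hb : b ∈ B <;> simp [principal, ha, hb]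

end Immanant

/-! ### Mixed permanent-determinant sums and their recursions -/

section Mixed

variable {V : Type*} [Fintype V] [DecidableEq V]

/-- The sum over `A ⊔ B = S` of `(-1) ^ |B|` times the permanent of `w` on `A` times the determinant
of `w` on `B`. -/
def permDet (w : V → V → ℤ) (S : Finset V) : ℤ :=
  ∑ B ∈ S.powerset, immanant 1 w (S \ B) * ((-1) ^ B.card * immanant sign w B)

/-- `permDet` on `S`, with the permanents bordered by the row of a vertex `u ∉ S` and the
column `c`. -/
def borderPerm (w : V → V → ℤ) (c : V → ℤ) (S : Finset V) (u : V) : ℤ :=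
  ∑ B ∈ S.powerset,
    immanant 1 (setCol w u c) (insert u (S \ B)) * ((-1) ^ B.card * immanant sign w B)

/-- `permDet` on `S`, with the determinants bordered by the row of a vertex `u ∉ S` and the
column `c`. -/
def borderDet (w : V → V → ℤ) (c : V → ℤ) (S : Finset V) (u : V) : ℤ :=
  ∑ B ∈ S.powerset,
    immanant 1 w (S \ B) * ((-1) ^ B.card * immanant sign (setCol w u c) (insert u B))

theorem sum_powerset_sum_sdiff {α : Type*} [DecidableEq α] (S : Finset α) (g : Finset α → α → ℤ) :
    ∑ B ∈ S.powerset, ∑ x ∈ S \ B, g B x = ∑ x ∈ S, ∑ B ∈ (S.erase x).powerset, g B x := by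
  refine Finset.sum_comm' fun B x => ?_
  simp only [Finset.mem_powerset, Finset.mem_sdiff, Finset.subset_erase]
  tauto

theorem sum_powerset_sum_mem {α : Type*} [DecidableEq α] (S : Finset α) (g : Finset α → α → ℤ) :
    ∑ B ∈ S.powerset, ∑ x ∈ B, g B x =
      ∑ x ∈ S, ∑ B ∈ (S.erase x).powerset, g (insert x B) x := by
  rw [Finset.sum_sigma', Finset.sum_sigma']
  refine Finset.sum_bij' (fun p _ => ⟨p.2, p.1.erase p.2⟩) (fun p _ => ⟨insert p.1 p.2, p.1⟩)
    ?_ ?_ ?_ ?_ ?_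
  · rintro ⟨B, x⟩ h
    simp only [Finset.mem_sigma, Finset.mem_powerset] at h ⊢
    exact ⟨h.1 h.2, Finset.erase_subset_erase _ h.1⟩
  · rintro ⟨x, B⟩ h
    simp only [Finset.mem_sigma, Finset.mem_powerset, Finset.subset_erase] at h ⊢
    exact ⟨Finset.insert_subset h.1 h.2.1, Finset.mem_insert_self _ _⟩
  · rintro ⟨B, x⟩ h
    simp only [Finset.mem_sigma] at h
    simp [Finset.insert_erase h.2]
  · rintro ⟨x, B⟩ h
    simp only [Finset.mem_sigma, Finset.mem_powerset, Finset.subset_erase] at h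
    simp [Finset.erase_insert h.2.2]
  · rintro ⟨B, x⟩ h
    simp only [Finset.mem_sigma] at h
    simp [Finset.insert_erase h.2]

theorem borderPerm_eq (w : V → V → ℤ) (c : V → ℤ) {S : Finset V} {u : V} (hu : u ∉ S) :
    borderPerm w c S u =
      c u * permDet w S + ∑ x ∈ S, w u x * borderPerm w c (S.erase x) x := by
  have h1 : ∀ B ∈ S.powerset,
      immanant 1 (setCol w u c) (insert u (S \ B)) * ((-1) ^ B.card * immanant sign w B) =
      c u * (immanant 1 w (S \ B) * ((-1) ^ B.card * immanant sign w B)) +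
        ∑ x ∈ S \ B, w u x *
          (immanant 1 (setCol w x c) (S \ B) * ((-1) ^ B.card * immanant sign w B)) := by
    intro B _
    rw [immanant_insert (e := 1) (by simp) w (by simp [hu]), one_mul, add_mul, Finset.sum_mul]
    congr 1
    · ring
    · exact Finset.sum_congr rfl fun x _ => by ring
  rw [borderPerm, Finset.sum_congr rfl h1, Finset.sum_add_distrib, ← Finset.mul_sum,
    sum_powerset_sum_sdiff]
  congr 1
  refine Finset.sum_congr rfl fun x hx => ?_
  rw [borderPerm, Finset.mul_sum]
  refine Finset.sum_congr rfl fun B hB => ?_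
  rw [Finset.mem_powerset, Finset.subset_erase] at hB
  rw [Finset.erase_sdiff_comm, Finset.insert_erase (Finset.mem_sdiff.2 ⟨hx, hB.2⟩)]

theorem borderDet_eq (w : V → V → ℤ) (c : V → ℤ) {S : Finset V} {u : V} (hu : u ∉ S) :
    borderDet w c S u =
      c u * permDet w S + ∑ x ∈ S, w u x * borderDet w c (S.erase x) x := by
  have h1 : ∀ B ∈ S.powerset,
      immanant 1 w (S \ B) * ((-1) ^ B.card * immanant sign (setCol w u c) (insert u B)) =
      c u * (immanant 1 w (S \ B) * ((-1) ^ B.card * immanant sign w B)) +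
        ∑ x ∈ B, w u x *
          (immanant 1 w (S \ B) * (-(-1) ^ B.card * immanant sign (setCol w x c) B)) := by
    intro B hB
    rw [immanant_insert (e := -1) (fun x y h => by simp [sign_swap h]) w
      (fun h => hu (Finset.mem_powerset.1 hB h)), mul_add, mul_add]
    congr 1
    · ring
    · simp only [Finset.mul_sum]
      exact Finset.sum_congr rfl fun x _ => by ring
  rw [borderDet, Finset.sum_congr rfl h1, Finset.sum_add_distrib, ← Finset.mul_sum,
    sum_powerset_sum_mem]
  congr 1
  refine Finset.sum_congr rfl fun x hx => ?_
  rw [borderDet, Finset.mul_sum]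
  refine Finset.sum_congr rfl fun B hB => ?_
  rw [Finset.mem_powerset, Finset.subset_erase] at hB
  rw [Finset.card_insert_of_notMem hB.2, Finset.sdiff_insert, Finset.erase_sdiff_comm]
  ring

/-- Both sides satisfy the same recursion. -/
theorem borderPerm_eq_borderDet (w : V → V → ℤ) (c : V → ℤ) {S : Finset V} :
    ∀ u ∉ S, borderPerm w c S u = borderDet w c S u := by
  induction S using Finset.strongInduction with
  | H S ih =>
    intro u hu
    rw [borderPerm_eq w c hu, borderDet_eq w c hu]
    congr 1
    refine Finset.sum_congr rfl fun x hx => ?_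
    rw [ih _ (Finset.erase_ssubset hx) x (Finset.notMem_erase _ _)]

/-- As set functions, the principal permanents and the signed principal determinants are inverse
to each other under the product that sums over the splittings of a set. -/
theorem permDet_eq (w : V → V → ℤ) (S : Finset V) : permDet w S = if S = ∅ then 1 else 0 := by
  split_ifs with h
  · subst h
    have h1 : ∀ χ : Perm V →* ℤˣ, immanant χ w ∅ = 1 := by
      intro χ
      have h2 : permsOn (∅ : Finset V) = {1} := by
        ext σ
        simp [mem_permsOn, Perm.ext_iff]
      simp [immanant, h2]
    simp [permDet, h1]
  · obtain ⟨v, hv⟩ := Finset.nonempty_iff_ne_empty.2 h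
    rw [← Finset.insert_erase hv]
    have hv' : v ∉ S.erase v := Finset.notMem_erase _ _
    -- bordering by the own row and column of `v` gives the terms with `v ∈ A` and with `v ∈ B`
    have h1 := borderPerm_eq_borderDet w (fun a => w a v) v hv'
    rw [borderPerm, borderDet, setCol_self] at h1
    rw [permDet, Finset.sum_powerset_insert hv']
    have h2 : ∀ B ∈ (S.erase v).powerset,
        immanant 1 w (insert v (S.erase v) \ B) * ((-1) ^ B.card * immanant sign w B) =
        immanant 1 w (insert v (S.erase v \ B)) * ((-1) ^ B.card * immanant sign w B) := by
      intro B hB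
      rw [Finset.insert_sdiff_of_notMem _ fun h => hv' (Finset.mem_powerset.1 hB h)]
    have h3 : ∀ B ∈ (S.erase v).powerset,
        immanant 1 w (insert v (S.erase v) \ insert v B) *
          ((-1) ^ (insert v B).card * immanant sign w (insert v B)) =
        -(immanant 1 w (S.erase v \ B) * ((-1) ^ B.card * immanant sign w (insert v B))) := by
      intro B hB
      rw [Finset.card_insert_of_notMem fun h => hv' (Finset.mem_powerset.1 hB h),
        Finset.insert_sdiff_insert, Finset.sdiff_insert_of_notMem hv']
      ring
    rw [Finset.sum_congr rfl h2, Finset.sum_congr rfl h3, Finset.sum_neg_distrib, h1, add_neg_cancel]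

/-! ### Hamiltonian paths -/

/-- The weight `w u l₀ * w l₀ l₁ * ⋯` of the path that starts at `u` and goes on along `l`. -/
def pathWeight {V : Type*} (w : V → V → ℤ) : V → List V → ℤ
  | _, [] => 1
  | u, x :: l => w u x * pathWeight w x l

/-- The orderings of the set `S`, as lists. -/
def orderings {V : Type*} [DecidableEq V] (S : Finset V) : Finset (List V) :=
  S.val.lists.toFinset

theorem mem_orderings {V : Type*} [DecidableEq V] {S : Finset V} {l : List V} :
    l ∈ orderings S ↔ S.val = (l : Multiset V) := by
  rw [orderings, Multiset.mem_toFinset, Multiset.mem_lists_iff]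
  rfl

theorem orderings_empty {V : Type*} [DecidableEq V] : orderings (∅ : Finset V) = {[]} := by
  ext l
  simp [mem_orderings, eq_comm]

theorem sum_orderings {V : Type*} [DecidableEq V] {S : Finset V} (hS : S.Nonempty)
    (g : List V → ℤ) :
    ∑ l ∈ orderings S, g l = ∑ x ∈ S, ∑ l ∈ orderings (S.erase x), g (x :: l) := by
  rw [Finset.sum_sigma']
  symm
  refine Finset.sum_bij (fun p _ => p.1 :: p.2) ?_ ?_ ?_ ?_
  · rintro ⟨x, l⟩ h
    simp only [Finset.mem_sigma, mem_orderings, Finset.erase_val] at h ⊢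
    rw [← Multiset.cons_erase h.1, h.2]
    rfl
  · rintro ⟨x, l⟩ _ ⟨y, m⟩ _ h
    simp only [List.cons.injEq] at h
    simp [h.1, h.2]
  · rintro l hl
    rw [mem_orderings] at hl
    cases l with
    | nil => exact absurd hl (by simpa using hS.ne_empty)
    | cons x l =>
      have h1 : S.val = x ::ₘ (l : Multiset V) := hl
      refine ⟨⟨x, l⟩, ?_, rfl⟩
      simp only [Finset.mem_sigma, mem_orderings, Finset.erase_val, h1,
        Multiset.erase_cons_head, and_true]
      rw [← Finset.mem_val, h1]
      exact Multiset.mem_cons_self _ _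
  · simp

/-- The paths that start at `u` and then run through `S`, counted with weights. -/
theorem sum_pathWeight_eq_borderDet (w : V → V → ℤ) {S : Finset V} :
    ∀ u ∉ S, ∑ l ∈ orderings S, pathWeight w u l = borderDet w 1 S u := by
  induction S using Finset.strongInduction with
  | H S ih =>
    intro u hu
    rw [borderDet_eq w 1 hu, permDet_eq]
    rcases S.eq_empty_or_nonempty with rfl | hS
    · simp [orderings_empty, pathWeight]
    · rw [sum_orderings hS, if_neg hS.ne_empty, mul_zero, zero_add]
      refine Finset.sum_congr rfl fun x hx => ?_
      rw [← ih _ (Finset.erase_ssubset hx) x (Finset.notMem_erase _ _), Finset.mul_sum]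
      rfl

/-- The weight `w l₀ l₁ * w l₁ l₂ * ⋯` of the path along `l`. -/
def orderingWeight {V : Type*} (w : V → V → ℤ) : List V → ℤ
  | [] => 1
  | x :: l => pathWeight w x l

/-- The weighted number of Hamiltonian paths on `S` as a sum of products of permanents and
determinants. -/
theorem sum_orderingWeight (w : V → V → ℤ) (S : Finset V) :
    ∑ l ∈ orderings S, orderingWeight w l =
      ∑ B ∈ S.powerset, immanant 1 w (S \ B) * immanant sign (fun a b => 1 - w a b) B := by
  have h1 : ∀ B, immanant 1 w (S \ B) * immanant sign (fun a b => 1 - w a b) B =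
      immanant 1 w (S \ B) * ((-1) ^ B.card * immanant sign w B) +
      ∑ x ∈ B, immanant 1 w (S \ B) * (-(-1) ^ B.card * immanant sign (setCol w x 1) B) := by
    intro B
    have h2 : (fun a b => 1 - w a b) = fun a b => -(w a b - 1) := by
      funext a b
      ring
    rw [h2, immanant_neg, immanant_sign_sub_one, ← Finset.mul_sum, ← Finset.mul_sum]
    ring
  rw [Finset.sum_congr rfl fun B _ => h1 B, Finset.sum_add_distrib, ← permDet, permDet_eq,
    sum_powerset_sum_mem]
  rcases S.eq_empty_or_nonempty with rfl | hS
  · simp [orderings_empty, orderingWeight]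
  · rw [sum_orderings hS, if_neg hS.ne_empty, zero_add]
    refine Finset.sum_congr rfl fun x hx => ?_
    refine (sum_pathWeight_eq_borderDet w x (Finset.notMem_erase x S)).trans ?_
    rw [borderDet]
    refine Finset.sum_congr rfl fun B hB => ?_
    rw [Finset.mem_powerset, Finset.subset_erase] at hB
    rw [Finset.card_insert_of_notMem hB.2, Finset.sdiff_insert, Finset.erase_sdiff_comm]
    ring

end Mixed

/-! ### Choosing some of the cycles of a permutation -/

section Cycles

variable {V : Type*} [Fintype V] [DecidableEq V]

theorem sign_eq_prod_cycleFactorsFinset (σ : Perm V) :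
    sign σ = ∏ c ∈ σ.cycleFactorsFinset, sign c := by
  conv_lhs => rw [← cycleFactorsFinset_noncommProd σ]
  rw [Finset.map_noncommProd, Finset.noncommProd_eq_prod]
  rfl

/-- Every set of cycles of `σ` splits `σ` into two disjoint factors. -/
theorem exists_disjoint_factors (σ : Perm V) {T : Finset (Perm V)}
    (hT : T ⊆ σ.cycleFactorsFinset) :
    ∃ α β : Perm V, Disjoint α β ∧ α * β = σ ∧ β.cycleFactorsFinset = T := by
  have hd := cycleFactorsFinset_pairwise_disjoint σ
  have hc := cycleFactorsFinset_mem_commute σ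
  have hT' : (σ.cycleFactorsFinset \ T : Finset (Perm V)) ⊆ σ.cycleFactorsFinset :=
    Finset.sdiff_subset
  refine ⟨(σ.cycleFactorsFinset \ T).noncommProd id (hc.mono (by exact_mod_cast hT')),
    T.noncommProd id (hc.mono (by exact_mod_cast hT)), ?_, ?_, ?_⟩
  · refine disjoint_noncommProd_right _ fun c hcT => ?_
    refine (disjoint_noncommProd_right _ fun d hdT => ?_).symm
    rw [Finset.mem_sdiff] at hdT
    refine hd (hT hcT) hdT.1 ?_
    rintro rfl
    exact hdT.2 hcT
  · rw [← Finset.noncommProd_union_of_disjoint Finset.sdiff_disjoint]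
    · conv_rhs => rw [← cycleFactorsFinset_noncommProd σ]
      congr 1
      exact Finset.sdiff_union_of_subset hT
    · rw [Finset.sdiff_union_of_subset hT]
      exact hc
  · rw [cycleFactorsFinset_eq_finset]
    exact ⟨fun c h => (mem_cycleFactorsFinset_iff.1 (hT h)).1,
      hd.mono (by exact_mod_cast hT), rfl⟩

variable (R : V → V → Prop)

/-- The permutations `σ` all of whose nontrivial cycles run along `R`. -/
def permsAlong : Set (Perm V) :=
  {σ | ∀ c ∈ σ.cycleFactorsFinset, ∀ v ∈ c.support, R v (c v)}

theorem mem_permsAlong {R : V → V → Prop} {σ : Perm V} :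
    σ ∈ permsAlong R ↔ ∀ v, σ v ≠ v → R v (σ v) := by
  constructor
  · intro h v hv
    have h1 := h (σ.cycleOf v) (cycleOf_mem_cycleFactorsFinset_iff.2 (mem_support.2 hv)) v
      (by rw [mem_support, cycleOf_apply_self]; exact hv)
    rwa [cycleOf_apply_self] at h1
  · intro h c hc v hv
    have h1 := (mem_cycleFactorsFinset_iff.1 hc).2 v hv
    rw [mem_support, h1] at hv
    rw [h1]
    exact h v hv

theorem mul_mem_permsAlong {R : V → V → Prop} {α β : Perm V} (h : Disjoint α β) :
    α * β ∈ permsAlong R ↔ α ∈ permsAlong R ∧ β ∈ permsAlong R := by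
  simp only [permsAlong, Set.mem_ofPred_eq, h.cycleFactorsFinset_mul_eq_union, Finset.mem_union]
  exact ⟨fun h => ⟨fun c hc => h c (Or.inl hc), fun c hc => h c (Or.inr hc)⟩,
    fun h c hc => hc.elim (h.1 c) (h.2 c)⟩

open scoped Classical in
/-- Pairs of disjoint permutations along `R` are permutations along `R` with some of their cycles
marked. -/
theorem sum_sign_disjoint :
    ∑ β : Perm V with β ∈ permsAlong R, ∑ α : Perm V with α ∈ permsAlong R ∧ Disjoint α β,
        (sign β : ℤ) =
      ∑ σ : Perm V with σ ∈ permsAlong R, ∏ c ∈ σ.cycleFactorsFinset, (1 + (sign c : ℤ)) := by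
  simp only [Finset.prod_one_add]
  rw [Finset.sum_sigma', Finset.sum_sigma']
  refine Finset.sum_bij (fun p _ => ⟨p.2 * p.1, p.1.cycleFactorsFinset⟩) ?_ ?_ ?_ ?_
  · rintro ⟨β, α⟩ h
    simp only [Finset.mem_sigma, Finset.mem_filter, Finset.mem_univ, true_and,
      Finset.mem_powerset] at h ⊢
    obtain ⟨hβ, hα, hd⟩ := h
    refine ⟨(mul_mem_permsAlong hd).2 ⟨hα, hβ⟩, ?_⟩
    rw [hd.cycleFactorsFinset_mul_eq_union]
    exact Finset.subset_union_right
  · rintro ⟨β, α⟩ _ ⟨β', α'⟩ _ h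
    simp only [Sigma.mk.injEq, heq_eq_eq] at h
    obtain rfl := cycleFactorsFinset_injective h.2
    obtain rfl := mul_right_cancel h.1
    rfl
  · rintro ⟨σ, T⟩ h
    simp only [Finset.mem_sigma, Finset.mem_filter, Finset.mem_univ, true_and,
      Finset.mem_powerset] at h
    obtain ⟨α, β, hd, rfl, rfl⟩ := exists_disjoint_factors σ h.2
    have h1 := (mul_mem_permsAlong hd).1 h.1
    exact ⟨⟨β, α⟩, by simp [h1.1, h1.2, hd], rfl⟩
  · rintro ⟨β, α⟩ _
    simp only
    rw [sign_eq_prod_cycleFactorsFinset β]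
    simp

open scoped Classical in
theorem immanant_one_rel_or_eq [DecidableRel R] (A : Finset V) :
    immanant 1 (fun a b => if R a b ∨ a = b then 1 else 0) A =
      ∑ α : Perm V with α ∈ permsAlong R ∧ α ∈ permsOn A, (1 : ℤ) := by
  rw [immanant, Finset.sum_filter, ← Finset.univ_inter (permsOn A), ← Finset.sum_ite_mem]
  refine Finset.sum_congr rfl fun σ _ => ?_
  by_cases h : σ ∈ permsOn A
  · simp only [Finset.univ_inter, h, if_true, and_true, MonoidHom.one_apply, Units.val_one, one_mul,
      Finset.prod_boole]
    congr 1
    rw [mem_permsAlong, eq_iff_iff]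
    constructor
    · intro h1 v hv
      have hvA : v ∈ A := by
        by_contra hvA
        exact hv (mem_permsOn.1 h v hvA)
      exact (h1 v hvA).resolve_right (Ne.symm hv)
    · intro h1 v _
      by_cases hv : σ v = v
      · exact Or.inr hv.symm
      · exact Or.inl (h1 v hv)
  · simp [h]

open scoped Classical in
theorem immanant_sign_rel [DecidableRel R] (hR : ∀ v, ¬ R v v) (B : Finset V) :
    immanant sign (fun a b => if R a b then 1 else 0) B =
      ∑ β : Perm V with β ∈ permsAlong R ∧ β.support = B, (sign β : ℤ) := by
  rw [immanant, Finset.sum_filter, ← Finset.univ_inter (permsOn B), ← Finset.sum_ite_mem]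
  refine Finset.sum_congr rfl fun σ _ => ?_
  have h : (σ ∈ permsOn B ∧ ∀ a ∈ B, R a (σ a)) ↔ σ ∈ permsAlong R ∧ σ.support = B := by
    rw [mem_permsAlong]
    constructor
    · rintro ⟨h1, h2⟩
      have h3 : ∀ v, σ v ≠ v → v ∈ B := fun v hv => by
        by_contra hvB
        exact hv (mem_permsOn.1 h1 v hvB)
      refine ⟨fun v hv => h2 v (h3 v hv), ?_⟩
      ext v
      rw [mem_support]
      refine ⟨h3 v, fun hv h4 => hR v ?_⟩
      have h5 := h2 v hv
      rwa [h4] at h5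
    · rintro ⟨h1, rfl⟩
      exact ⟨mem_permsOn.2 fun a ha => by simpa using ha, fun a ha => h1 a (mem_support.1 ha)⟩
  rw [Finset.prod_boole, ← if_congr h rfl rfl, ite_and]
  simp

open scoped Classical in
/-- If `R` is irreflexive, the permutations in the second factor have support `B`, so that the left
side runs over the permutations along `R` with some of their cycles marked. -/
theorem sum_immanant_rel [DecidableRel R] (hR : ∀ v, ¬ R v v) :
    ∑ B ∈ (Finset.univ : Finset V).powerset,
        immanant 1 (fun a b => if R a b ∨ a = b then 1 else 0) (Finset.univ \ B) *
          immanant sign (fun a b => if R a b then 1 else 0) B =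
      ∑ σ : Perm V with σ ∈ permsAlong R ∧ ∀ c ∈ σ.cycleFactorsFinset, Odd c.support.card,
        2 ^ σ.cycleFactorsFinset.card := by
  have h1 : ∀ σ : Perm V, ∏ c ∈ σ.cycleFactorsFinset, (1 + (sign c : ℤ)) =
      if ∀ c ∈ σ.cycleFactorsFinset, Odd c.support.card then
        2 ^ σ.cycleFactorsFinset.card else 0 := by
    intro σ
    split_ifs with h
    · rw [← Finset.prod_const]
      refine Finset.prod_congr rfl fun c hc => ?_
      simp [(mem_cycleFactorsFinset_iff.1 hc).1.sign, (h c hc).neg_one_pow]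
    · push Not at h
      obtain ⟨c, hc, hodd⟩ := h
      refine Finset.prod_eq_zero hc ?_
      rw [Nat.not_odd_iff_even] at hodd
      simp [(mem_cycleFactorsFinset_iff.1 hc).1.sign, hodd.neg_one_pow]
  rw [← Finset.filter_filter, Finset.sum_filter (p := fun σ : Perm V =>
    ∀ c ∈ σ.cycleFactorsFinset, Odd c.support.card), ← Finset.sum_congr rfl fun σ _ => h1 σ,
    ← sum_sign_disjoint R, Finset.powerset_univ]
  rw [← Finset.sum_fiberwise _ (fun β : Perm V => β.support)]
  refine Finset.sum_congr rfl fun B _ => ?_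
  rw [immanant_one_rel_or_eq, immanant_sign_rel R hR, Finset.mul_sum, Finset.filter_filter]
  refine Finset.sum_congr rfl fun β hβ => ?_
  rw [Finset.sum_mul]
  simp only [one_mul]
  refine Finset.sum_congr ?_ fun _ _ => rfl
  ext α
  simp only [Finset.mem_filter, Finset.mem_univ, true_and] at hβ ⊢
  refine and_congr_right fun _ => ?_
  rw [mem_permsOn, ← hβ.2]
  simp only [Finset.mem_sdiff, Finset.mem_univ, true_and, not_not, mem_support]
  exact forall_congr' fun v => by tauto

end Cycles

/-! ### Vertex labellings -/

section Labelling

theorem orderingWeight_boole {V : Type*} (r : V → V → Prop) [DecidableRel r] (l : List V) :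
    orderingWeight (fun a b => if r a b then 1 else 0) l = if l.IsChain r then 1 else 0 := by
  cases l with
  | nil => simp [orderingWeight]
  | cons x l =>
    rw [orderingWeight]
    induction l generalizing x with
    | nil => simp [pathWeight]
    | cons y l ih =>
      rw [pathWeight, ih]
      by_cases h : r x y <;> simp [h]

variable {V : Type*} [Fintype V] [DecidableEq V]

/-- If the entries of `w` that go down in `f` vanish, those that go up do not contribute: a
permutation that never decreases `f` preserves it, as the sum of `f` does not change. -/
theorem immanant_eq_of_level {χ : Perm V →* ℤˣ} {w w₁ : V → V → ℤ} (f : V → ℤ)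
    (heq : ∀ a b, f a = f b → w a b = w₁ a b) (hlt : ∀ a b, f b < f a → w a b = 0)
    (hne : ∀ a b, f a ≠ f b → w₁ a b = 0) (A : Finset V) :
    immanant χ w A = immanant χ w₁ A := by
  refine Finset.sum_congr rfl fun σ hσ => ?_
  congr 1
  by_cases h : ∀ a ∈ A, f a = f (σ a)
  · exact Finset.prod_congr rfl fun a ha => heq _ _ (h a ha)
  · push Not at h
    obtain ⟨a, ha, hfa⟩ := h
    have h0 : ∏ b ∈ A, w₁ b (σ b) = 0 := Finset.prod_eq_zero ha (hne _ _ hfa)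
    rw [h0]
    have h1 : ∑ b ∈ A, f (σ b) = ∑ b ∈ A, f b := by
      refine Finset.sum_bij' (fun b _ => σ b) (fun b _ => σ⁻¹ b) ?_ ?_ ?_ ?_ ?_
      · exact fun b hb => (apply_mem_of_mem_permsOn hσ).2 hb
      · intro b hb
        rw [← apply_mem_of_mem_permsOn hσ]
        simpa using hb
      · simp
      · simp
      · simp
    by_cases h2 : ∃ b ∈ A, f (σ b) < f b
    · obtain ⟨b, hb, hlt'⟩ := h2
      exact Finset.prod_eq_zero hb (hlt _ _ hlt')
    · push Not at h2
      exact absurd h1 (Finset.sum_lt_sum h2 ⟨a, ha, lt_of_le_of_ne (h2 a ha) hfa⟩).ne'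

theorem sum_orderings_univ {n : ℕ} (g : List (Fin n) → ℤ) :
    ∑ l ∈ orderings (Finset.univ : Finset (Fin n)), g l =
      ∑ π : Perm (Fin n), g (List.ofFn π) := by
  symm
  refine Finset.sum_bij (fun π _ => List.ofFn π) ?_ ?_ ?_ ?_
  · intro π _
    rw [mem_orderings, Multiset.Nodup.ext Finset.univ.nodup]
    · intro a
      simpa [List.mem_ofFn] using π.surjective a
    · simpa [List.nodup_ofFn] using π.injective
  · intro π _ π' _ h
    exact DFunLike.coe_injective (List.ofFn_injective h)
  · intro l hl
    rw [mem_orderings] at hl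
    have h1 : l.length = n := by simpa using (congrArg Multiset.card hl).symm
    have h2 : l.Nodup := by
      rw [← Multiset.coe_nodup, ← hl]
      exact Finset.univ.nodup
    refine ⟨Equiv.ofBijective (l.get ∘ Fin.cast h1.symm) (Finite.injective_iff_bijective.1
      ((List.nodup_iff_injective_get.1 h2).comp (Fin.cast_injective _))), Finset.mem_univ _, ?_⟩
    exact List.ext_getElem (by simp [h1]) (by simp)
  · simp

end Labelling

open scoped Classical in
/-- Listing the vertices so that the label never decreases, with no edge of the tournament between
neighbours of the same label, is counted by the permutations with odd cycles along the edges whose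
ends have the same label. -/
theorem sum_chain_eq {n : ℕ} {D : Digraph (Fin n)} (hD : IsTournament D) (f : Fin n → ℕ) :
    ∑ π : Perm (Fin n),
        (if (List.ofFn π).IsChain (fun a b => f a < f b ∨ f a = f b ∧ ¬ D.Adj a b) then 1 else 0) =
      ∑ σ : Perm (Fin n) with σ ∈ permsAlong (fun a b => f a = f b ∧ D.Adj a b) ∧
        ∀ c ∈ σ.cycleFactorsFinset, Odd c.support.card, (2 : ℤ) ^ σ.cycleFactorsFinset.card := by
  rw [← sum_immanant_rel _ fun v h => hD.1 v h.2]
  have h := sum_orderingWeight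
    (fun a b => if f a < f b ∨ f a = f b ∧ ¬ D.Adj a b then 1 else 0) Finset.univ
  rw [sum_orderings_univ] at h
  refine (Finset.sum_congr rfl fun π _ => ?_).trans (h.trans ?_)
  · rw [orderingWeight_boole]
  refine Finset.sum_congr rfl fun B _ => ?_
  congr 1
  · rw [← immanant_one_transpose (fun a b => if (f a = f b ∧ D.Adj a b) ∨ a = b then 1 else 0)]
    refine immanant_eq_of_level (fun a => (f a : ℤ)) ?_ ?_ ?_ _
    · intro a b h
      have h : f a = f b := by exact_mod_cast h
      refine if_congr ?_ rfl rfl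
      by_cases hab : a = b
      · simp [hab, hD.1 b]
      · have := hD.2 a b hab
        rw [xor_def] at this
        simp only [h, lt_irrefl, false_or, true_and, Ne.symm hab, or_false]
        tauto
    · intro a b h
      have h : f b < f a := by exact_mod_cast h
      exact if_neg (by omega)
    · intro a b h
      have h : f a ≠ f b := by exact_mod_cast h
      refine if_neg ?_
      rintro (h1 | h1)
      · exact h h1.1.symm
      · exact h (by rw [h1])
  · refine immanant_eq_of_level (fun a => -(f a : ℤ)) ?_ ?_ ?_ _
    · intro a b h
      have h : f a = f b := by simpa using h
      by_cases h1 : D.Adj a b <;> simp [h, h1]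
    · intro a b h
      have h : f a < f b := by simpa using h
      simp [h]
    · intro a b h
      have h : f a ≠ f b := by simpa using h
      simp [h]

/-! ### Coefficients of the power sums -/

/-- Positive lengths are needed: the labels of parts of length zero are arbitrary. -/
theorem finite_labels {ι : Type*} [Fintype ι] {ℓ : ι → ℕ} (hℓ : ∀ i, ℓ i ≠ 0) (m : ℕ →₀ ℕ) :
    {g : ι → ℕ | ∑ i, Finsupp.single (g i) (ℓ i) = m}.Finite := by
  refine (Set.Finite.pi' (fun _ : ι => m.support.finite_toSet)).subset ?_
  rintro g rfl i
  simp only [Finset.mem_coe, Finsupp.mem_support_iff, Finsupp.finsetSum_apply]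
  intro h
  have := (Finset.sum_eq_zero_iff.1 h) i (Finset.mem_univ i)
  simp [hℓ i] at this

theorem coeff_prod_powerSum {ι : Type*} [Fintype ι] {ℓ : ι → ℕ} (hℓ : ∀ i, ℓ i ≠ 0)
    (m : ℕ →₀ ℕ) :
    MvPowerSeries.coeff m (∏ i, powerSum (ℓ i)) =
      ({g : ι → ℕ | ∑ i, Finsupp.single (g i) (ℓ i) = m}.ncard : ℚ) := by
  classical
  have hfin := finite_labels hℓ m
  rw [MvPowerSeries.coeff_prod, Set.ncard_eq_toFinset_card _ hfin,
    Finset.card_eq_sum_card_fiberwise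
      (f := fun g => Finsupp.equivFunOnFinite.symm fun i => Finsupp.single (g i) (ℓ i))
      (t := Finset.finsuppAntidiag Finset.univ m)]
  · rw [Nat.cast_sum]
    refine Finset.sum_congr rfl fun l hl => ?_
    rw [Finset.mem_finsuppAntidiag] at hl
    have h1 : ∀ i, MvPowerSeries.coeff (l i) (powerSum (ℓ i)) =
        (Nat.card {x : ℕ // Finsupp.single x (ℓ i) = l i} : ℚ) := fun _ => rfl
    rw [Finset.prod_congr rfl fun i _ => h1 i, ← Nat.cast_prod, ← Nat.card_pi, Nat.cast_inj,
      ← Nat.card_eq_finsetCard]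
    refine (Nat.card_congr ((Equiv.subtypeEquivRight fun g => ?_).trans
      Equiv.subtypePiEquivPi)).symm
    simp only [Finset.mem_filter, Set.Finite.mem_toFinset, Set.mem_ofPred_eq]
    constructor
    · rintro ⟨_, rfl⟩ i
      rfl
    · intro h
      have h2 : (Finsupp.equivFunOnFinite.symm fun i => Finsupp.single (g i) (ℓ i)) = l :=
        Finsupp.ext h
      refine ⟨?_, h2⟩
      rw [← hl.1]
      exact Finset.sum_congr rfl fun i _ => h i
  · intro g hg
    simp only [Set.Finite.coe_toFinset, Set.mem_ofPred_eq, Finset.mem_coe,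
      Finset.mem_finsuppAntidiag] at hg ⊢
    exact ⟨hg, Finset.subset_univ _⟩

section Cycles

variable {n : ℕ} (σ : Perm (Fin n))

/-- The cycle of `σ` through `v`: a nontrivial cycle, or a fixed point. -/
def cycleThrough (v : Fin n) : {c // c ∈ σ.cycleFactorsFinset} ⊕ {v // σ v = v} :=
  if h : σ v = v then Sum.inr ⟨v, h⟩
  else Sum.inl ⟨σ.cycleOf v, cycleOf_mem_cycleFactorsFinset_iff.2 (mem_support.2 h)⟩

/-- The length of a nontrivial cycle or of a fixed point. -/
def cycleLength (i : {c // c ∈ σ.cycleFactorsFinset} ⊕ {v // σ v = v}) : ℕ :=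
  Sum.elim (fun c => c.1.support.card) (fun _ => 1) i

theorem cycleLength_ne_zero (i) : cycleLength σ i ≠ 0 := by
  rcases i with ⟨c, hc⟩ | v
  · have := (mem_cycleFactorsFinset_iff.1 hc).1.two_le_card_support
    simp only [cycleLength, Sum.elim_inl]
    omega
  · simp [cycleLength]

theorem card_filter_cycleThrough (i) :
    (Finset.univ.filter fun v => cycleThrough σ v = i).card = cycleLength σ i := by
  rcases i with ⟨c, hc⟩ | ⟨u, hu⟩
  · simp only [cycleLength, Sum.elim_inl]
    congr 1
    ext v
    rw [Finset.mem_filter, cycleThrough, and_iff_right (Finset.mem_univ v)]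
    split_ifs with h
    · simp only [false_iff]
      intro hv
      exact mem_support.1 (mem_cycleFactorsFinset_support_le hc hv) h
    · simp only [Sum.inl.injEq, Subtype.mk.injEq]
      constructor
      · rintro rfl
        rw [mem_support, cycleOf_apply_self]
        exact h
      · exact fun hv => (cycle_is_cycleOf hv hc).symm
  · simp only [cycleLength, Sum.elim_inr, Finset.card_eq_one]
    refine ⟨u, ?_⟩
    ext v
    rw [Finset.mem_filter, cycleThrough, and_iff_right (Finset.mem_univ v), Finset.mem_singleton]
    split_ifs with h
    · simp
    · simp only [false_iff]
      rintro rfl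
      exact h hu

theorem cycleThrough_surjective : Function.Surjective (cycleThrough σ) := by
  intro i
  have h := card_filter_cycleThrough σ i
  have h1 := cycleLength_ne_zero σ i
  rw [← h, Finset.card_ne_zero] at h1
  obtain ⟨v, hv⟩ := h1
  exact ⟨v, (Finset.mem_filter.1 hv).2⟩

theorem cycleThrough_apply (v : Fin n) : cycleThrough σ (σ v) = cycleThrough σ v := by
  by_cases h : σ v = v
  · rw [h]
  · have h1 : σ (σ v) ≠ σ v := fun h2 => h (σ.injective h2)
    have h2 : σ.cycleOf (σ v) = σ.cycleOf v :=
      (sameCycle_apply_left.2 (SameCycle.refl σ v)).cycleOf_eq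
    simp [cycleThrough, h, h1, h2]

theorem eq_of_cycleThrough_eq {f : Fin n → ℕ} (hf : ∀ v, f (σ v) = f v) {u v : Fin n}
    (h : cycleThrough σ u = cycleThrough σ v) : f u = f v := by
  have h1 : ∀ (k : ℕ) (a : Fin n), f ((σ ^ k) a) = f a := by
    intro k
    induction k with
    | zero => simp
    | succ k ih =>
      intro a
      rw [pow_succ', mul_apply, hf, ih]
  simp only [cycleThrough] at h
  split_ifs at h with hu hv hv
  · simp only [Sum.inr.injEq, Subtype.mk.injEq] at h
    rw [h]
  · simp only [Sum.inl.injEq, Subtype.mk.injEq] at h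
    have h2 := (sameCycle_iff_cycleOf_eq_of_mem_support (mem_support.2 hu) (mem_support.2 hv)).2 h
    obtain ⟨k, _, _, rfl⟩ := h2.exists_pow_eq
    exact (h1 k u).symm

theorem powerSumPartition_partition :
    powerSumPartition σ.partition = ∏ i, powerSum (cycleLength σ i) := by
  rw [powerSumPartition, parts_partition, Multiset.map_add, Multiset.prod_add, cycleType_def,
    Multiset.map_map, Multiset.map_replicate, Multiset.prod_replicate, Fintype.prod_sum_type]
  congr 1
  · exact (Finset.prod_coe_sort σ.cycleFactorsFinset fun c => powerSum c.support.card).symm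
  · simp only [cycleLength, Sum.elim_inr, Finset.prod_const, Finset.card_univ]
    congr 1
    rw [Fintype.card_subtype, ← Finset.card_compl]
    congr 1
    ext v
    simp

/-- The power sum of the cycle type of `σ` counts the labellings that are constant on the cycles
of `σ`. -/
theorem coeff_powerSumPartition (m : ℕ →₀ ℕ) :
    MvPowerSeries.coeff m (powerSumPartition σ.partition) =
      ∑ f ∈ (finite_words (n := n) m).toFinset, if ∀ v, f (σ v) = f v then (1 : ℚ) else 0 := by
  rw [powerSumPartition_partition, coeff_prod_powerSum (cycleLength_ne_zero σ), Finset.sum_boole,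
    Nat.cast_inj]
  have hinj : Function.Injective fun g : _ → ℕ => g ∘ cycleThrough σ :=
    (cycleThrough_surjective σ).injective_comp_right
  rw [← Set.ncard_image_of_injective _ hinj, ← Set.ncard_coe_finset]
  congr 1
  have hexp : ∀ g, wordExponent (g ∘ cycleThrough σ) =
      ∑ i, Finsupp.single (g i) (cycleLength σ i) := by
    intro g
    rw [wordExponent, ← Finset.sum_fiberwise _ (cycleThrough σ)]
    refine Finset.sum_congr rfl fun i _ => ?_
    rw [← card_filter_cycleThrough, Finset.sum_congr rfl (g := fun _ => Finsupp.single (g i) 1)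
      fun v hv => by rw [Function.comp_apply, (Finset.mem_filter.1 hv).2]]
    simp
  ext f
  simp only [Set.mem_image, Set.mem_ofPred_eq, Finset.coe_filter, Set.Finite.mem_toFinset]
  constructor
  · rintro ⟨g, hg, rfl⟩
    exact ⟨by rw [hexp, hg], fun v => by simp [cycleThrough_apply]⟩
  · rintro ⟨hf, hσ⟩
    have hg : (f ∘ Function.surjInv (cycleThrough_surjective σ)) ∘ cycleThrough σ = f := by
      funext v
      exact eq_of_cycleThrough_eq σ hσ (Function.surjInv_eq (cycleThrough_surjective σ) _)
    exact ⟨_, by rw [← hexp, hg, hf], hg⟩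

end Cycles

/-! ### Coefficients of the Rédei–Berge function -/

open scoped Classical in
theorem coeff_fundamental {n : ℕ} (I : Set (Fin (n - 1))) (m : ℕ →₀ ℕ) :
    MvPowerSeries.coeff m (fundamental n I) =
      ∑ s ∈ (finite_words (n := n) m).toFinset, if Admissible n I s then (1 : ℚ) else 0 := by
  rw [Finset.sum_boole, ← Set.ncard_coe_finset]
  change ((_ : ℕ) : ℚ) = _
  congr 2
  ext s
  simp [and_comm]

theorem admissible_descents_iff {n : ℕ} (D : Digraph (Fin n)) (f : Fin n → ℕ)
    (π : Perm (Fin n)) :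
    Admissible n (descents D π) (f ∘ π) ↔
      (List.ofFn π).IsChain (fun a b => f a < f b ∨ f a = f b ∧ ¬ D.Adj a b) := by
  rw [List.isChain_ofFn, Admissible]
  have hmono : Monotone (f ∘ π) ↔ ∀ (i : ℕ) (hi : i + 1 < n),
      f (π ⟨i, by omega⟩) ≤ f (π ⟨i + 1, hi⟩) := by
    cases n with
    | zero => exact ⟨fun _ i hi => by omega, fun _ a => a.elim0⟩
    | succ n =>
      rw [Fin.monotone_iff_le_succ]
      exact ⟨fun h i hi => h ⟨i, by omega⟩, fun h i => h i.1 (by omega)⟩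
  rw [hmono]
  constructor
  · rintro ⟨h1, h2⟩ i hi
    rcases (h1 i hi).lt_or_eq with h3 | h3
    · exact Or.inl h3
    · exact Or.inr ⟨h3, fun h4 => (h2 ⟨i, by omega⟩ h4).ne h3⟩
  · intro h
    refine ⟨fun i hi => (h i hi).elim le_of_lt fun h1 => h1.1.le, fun j hj => ?_⟩
    exact (h j.1 (by omega)).resolve_right fun h1 => h1.2 hj

open scoped Classical in
/-- A pair of a permutation `π` and a word `s` is a listing of the vertices with the labelling
`f = s ∘ π⁻¹`, which has the same monomial. -/
theorem coeff_redeiBerge {n : ℕ} (D : Digraph (Fin n)) (m : ℕ →₀ ℕ) :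
    MvPowerSeries.coeff m (redeiBerge D) =
      ∑ f ∈ (finite_words (n := n) m).toFinset, ∑ π : Perm (Fin n),
        if (List.ofFn π).IsChain (fun a b => f a < f b ∨ f a = f b ∧ ¬ D.Adj a b) then (1 : ℚ)
        else 0 := by
  rw [redeiBerge, map_sum, Finset.sum_comm]
  refine Finset.sum_congr rfl fun π _ => ?_
  rw [coeff_fundamental]
  have hexp : ∀ (τ : Perm (Fin n)) (s : Fin n → ℕ), wordExponent (s ∘ τ) = wordExponent s :=
    fun τ s => Equiv.sum_comp τ fun j => Finsupp.single (s j) 1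
  refine Finset.sum_bij' (fun s _ => s ∘ (π⁻¹ : Perm (Fin n))) (fun f _ => f ∘ π) ?_ ?_ ?_ ?_ ?_
  · intro s hs
    simpa [hexp] using hs
  · intro s hs
    simpa [hexp] using hs
  · intro s _
    funext j
    simp
  · intro s _
    funext j
    simp
  · intro s _
    refine if_congr ?_ rfl rfl
    rw [← admissible_descents_iff]
    have : (s ∘ (π⁻¹ : Perm (Fin n))) ∘ ⇑π = s := by
      funext j
      simp
    rw [this]

theorem odd_parts_iff {n : ℕ} (σ : Perm (Fin n)) :
    (∀ l ∈ σ.partition.parts, Odd l) ↔ ∀ c ∈ σ.cycleFactorsFinset, Odd c.support.card := by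
  simp only [parts_partition, cycleType_def, Multiset.mem_add, Multiset.mem_map,
    Multiset.mem_replicate, Function.comp_apply, Finset.mem_val]
  constructor
  · exact fun h c hc => h _ (Or.inl ⟨c, hc, rfl⟩)
  · rintro h l (⟨c, hc, rfl⟩ | ⟨_, rfl⟩)
    · exact h c hc
    · exact odd_one

theorem mem_permsAlong_level_iff {n : ℕ} (D : Digraph (Fin n)) (f : Fin n → ℕ)
    (σ : Perm (Fin n)) :
    σ ∈ permsAlong (fun a b => f a = f b ∧ D.Adj a b) ↔
      σ ∈ cyclePerms D ∧ ∀ v, f (σ v) = f v := by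
  have h1 : σ ∈ cyclePerms D ↔ σ ∈ permsAlong D.Adj :=
    forall₂_congr fun c hc => and_iff_right (mem_cycleFactorsFinset_iff.1 hc).1
  rw [h1, mem_permsAlong, mem_permsAlong]
  constructor
  · refine fun h => ⟨fun v hv => (h v hv).2, fun v => ?_⟩
    by_cases hv : σ v = v
    · rw [hv]
    · exact (h v hv).1.symm
  · exact fun h v hv => ⟨(h.2 v).symm, h.1 v hv⟩

/-! ### Power sum expansion and integrality -/

open scoped Classical in
theorem redeiBerge_eq_sum {n : ℕ} {D : Digraph (Fin n)} (hD : IsTournament D) :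
    redeiBerge D = ∑ σ : Perm (Fin n) with σ ∈ cyclePerms D ∧ ∀ l ∈ σ.partition.parts, Odd l,
      2 ^ numNontrivialCycles σ * powerSumPartition σ.partition := by
  ext m
  have h1 : ∀ σ : Perm (Fin n),
      MvPowerSeries.coeff m (2 ^ numNontrivialCycles σ * powerSumPartition σ.partition) =
        ∑ f ∈ (finite_words (n := n) m).toFinset,
          if ∀ v, f (σ v) = f v then (2 : ℚ) ^ numNontrivialCycles σ else 0 := by
    intro σ
    rw [show (2 : MvPowerSeries ℕ ℚ) ^ numNontrivialCycles σ * powerSumPartition σ.partition =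
      (2 ^ numNontrivialCycles σ : ℕ) • powerSumPartition σ.partition by simp, map_nsmul,
      coeff_powerSumPartition, nsmul_eq_mul, Finset.mul_sum]
    simp
  rw [map_sum, Finset.sum_congr rfl fun σ _ => h1 σ, Finset.sum_comm, coeff_redeiBerge]
  refine Finset.sum_congr rfl fun f _ => ?_
  have h2 := congrArg (Int.cast : ℤ → ℚ) (sum_chain_eq hD f)
  push_cast at h2
  rw [h2, ← Finset.sum_filter, Finset.filter_filter]
  refine Finset.sum_congr ?_ fun _ _ => rfl
  ext σ
  simp only [Finset.mem_filter, Finset.mem_univ, true_and, mem_permsAlong_level_iff, odd_parts_iff]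
  tauto

theorem two_pow_mul_powerSumPartition_mem {n : ℕ} {σ : Perm (Fin n)}
    (hσ : ∀ l ∈ σ.partition.parts, Odd l) :
    2 ^ numNontrivialCycles σ * powerSumPartition σ.partition ∈
      Algebra.adjoin ℤ ({powerSum 1} ∪ {f | ∃ k : ℕ, 1 ≤ k ∧ f = 2 * powerSum (2 * k + 1)}) := by
  rw [odd_parts_iff] at hσ
  have h1 : 2 ^ numNontrivialCycles σ * powerSumPartition σ.partition =
      (∏ c ∈ σ.cycleFactorsFinset, 2 * powerSum c.support.card) *
        powerSum 1 ^ (Fintype.card (Fin n) - σ.support.card) := by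
    rw [powerSumPartition, parts_partition, Multiset.map_add, Multiset.prod_add, cycleType_def,
      Multiset.map_map, Multiset.map_replicate, Multiset.prod_replicate,
      Finset.prod_mul_distrib, Finset.prod_const, numNontrivialCycles, mul_assoc]
    rfl
  rw [h1]
  refine Subalgebra.mul_mem _ (Subalgebra.prod_mem _ fun c hc => ?_)
    (Subalgebra.pow_mem _ (Algebra.subset_adjoin (Set.mem_union_left _ (Set.mem_singleton _))) _)
  refine Algebra.subset_adjoin (Set.mem_union_right _ ?_)
  obtain ⟨k, hk⟩ := hσ c hc
  have := (mem_cycleFactorsFinset_iff.1 hc).1.two_le_card_support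
  exact ⟨k, by omega, by rw [hk]⟩

end RedeiBerge

open scoped Classical in
theorem corollary19 (n : ℕ) (D : Digraph (Fin n)) (hD : RedeiBerge.IsTournament D) :
    RedeiBerge.redeiBerge D =
        ∑ σ : Equiv.Perm (Fin n) with
            σ ∈ RedeiBerge.cyclePerms D ∧ ∀ l ∈ σ.partition.parts, Odd l,
          2 ^ RedeiBerge.numNontrivialCycles σ * RedeiBerge.powerSumPartition σ.partition ∧
      RedeiBerge.redeiBerge D ∈
        Algebra.adjoin ℤ ({RedeiBerge.powerSum 1} ∪
          {f | ∃ k : ℕ, 1 ≤ k ∧ f = 2 * RedeiBerge.powerSum (2 * k + 1)}) := by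
  have h := RedeiBerge.redeiBerge_eq_sum hD
  refine ⟨h, ?_⟩
  rw [h]
  exact Subalgebra.sum_mem _ fun σ hσ =>
    RedeiBerge.two_pow_mul_powerSumPartition_mem (Finset.mem_filter.1 hσ).2.2
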